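/- Let $\mathcal{C}_2$ be the two-dimensional comb, that is, the graph with vertex set $\mathbb{Z}^2$ obtained from the square lattice by removing all horizontal edges except those on the $x$-axis, and let $o=(0,0)$. Let $\rho_0$ be the initial rotor configuration in which the rotor at $(x,y)$ points to $(x,y+1)$ if $y>0$, to $(x,y-1)$ if $y<0$, to $(x+1,0)$ if $y=0$ and $x\ge 0$, and to $(x-1,0)$ if $y=0$ and $x<0$. In a rotor-router walk with clockwise rotor sequences, a particle at a vertex $v$ first turns the rotor at $v$ to the next neighbour of $v$ in clockwise order (up, right, down, left on the $x$-axis; up, down off the $x$-axis) and then moves to the neighbour to which that rotor now points. Rotor-router aggregation is defined by $R_1=\{o\}$ and $R_{n+1}=R_n\cup\{z_n\}$ for $n\ge 1$, where $z_n$ is the first vertex outside $R_n$ visited by a rotor-router walk started at $o$; the walk stops there, the rotors start from $\rho_0$, and they are not reset between successive particles. For $m\ge 0$ let $$B_m=\big\{(x,y)\in\mathbb{Z}^2:\ |x|\le m,\ |y|\le h(m-|x|)\big\},\qquad h(x)=\left\lfloor\frac{(x+1)^2}{3}\right\rfloor .$$ Then for all $m\ge 0$, with $n_m=|B_m|$,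 the rotor-router cluster of $n_m$ particles satisfies $R_{n_m}=B_m$. -/

import Mathlib

/-! Rotor-router walks and rotor-router aggregation on a vertex set `V`. -/

namespace RotorRouter

variable {V : Type*} [DecidableEq V]

/-- The successor `y⁺` of `y` in the cyclic ordering `l = (x₀, …, x_{d-1})`:
if `y = x_i`, then `y⁺ = x_{(i+1) mod d}`. -/
def succ (l : List V) (y : V) : V :=
  l.getD ((l.idxOf y + 1) % l.length) y

/-- One step of the rotor-router walk with rotor sequences `c`. A state is a rotor configuration
together with the position of the particle: first the rotor at the current position is turned to
the next neighbour, then the particle moves to where that rotor now points. -/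
def step (c : V → List V) (s : (V → V) × V) : (V → V) × V :=
  (Function.update s.1 s.2 (succ (c s.2) (s.1 s.2)), succ (c s.2) (s.1 s.2))

/-- The state after `k` steps of the rotor-router walk started at `o` with rotors `ρ`. -/
def walk (c : V → List V) (o : V) (ρ : V → V) (k : ℕ) : (V → V) × V :=
  (step c)^[k] (ρ, o)

open Classical in
/-- One particle is added to the cluster `R`, with rotors `ρ`: it performs a rotor-router walk from
`o` until the first time it is outside `R`, and is added to the cluster there; the rotors stay as
the walk left them. (If the walk never left `R`, nothing would be added and the cluster would
from then on have fewer elements than particles.) -/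
noncomputable def addParticle (c : V → List V) (o : V) (s : Set V × (V → V)) : Set V × (V → V) :=
  if h : ∃ k, (walk c o s.2 k).2 ∉ s.1 then
    (s.1 ∪ {(walk c o s.2 (Nat.find h)).2}, (walk c o s.2 (Nat.find h)).1)
  else s

/-- The cluster and the rotor configuration after `n` particles, where `R₁ = {o}` and the initial
rotor configuration is `ρ₀`. -/
noncomputable def aggregation (c : V → List V) (o : V) (ρ₀ : V → V) : ℕ → Set V × (V → V)
  | 0 => (∅, ρ₀)
  | 1 => ({o}, ρ₀)
  | n + 2 => addParticle c o (aggregation c o ρ₀ (n + 1))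

/-- The rotor-router cluster `R_n` of `n` particles. -/
noncomputable def cluster (c : V → List V) (o : V) (ρ₀ : V → V) (n : ℕ) : Set V :=
  (aggregation c o ρ₀ n).1

end RotorRouter

namespace Comb

/-- The two-dimensional comb: the subgraph of the square lattice `ℤ²` with all vertical edges, and
only those horizontal edges that lie on the `x`-axis. -/
def graph : SimpleGraph (ℤ × ℤ) where
  Adj u v := (u.1 = v.1 ∧ |u.2 - v.2| = 1) ∨ (u.2 = 0 ∧ v.2 = 0 ∧ |u.1 - v.1| = 1)
  symm := ⟨fun u v h => by
    rcases h with ⟨h1, h2⟩ | ⟨h1, h2, h3⟩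
    · exact Or.inl ⟨h1.symm, by rwa [abs_sub_comm]⟩
    · exact Or.inr ⟨h2, h1, by rwa [abs_sub_comm]⟩⟩
  loopless := ⟨fun u h => by simp at h⟩

instance : DecidableRel graph.Adj := fun u v =>
  inferInstanceAs (Decidable
    ((u.1 = v.1 ∧ |u.2 - v.2| = 1) ∨ (u.2 = 0 ∧ v.2 = 0 ∧ |u.1 - v.1| = 1)))

/-- The clockwise rotor sequence at `v`: the neighbours of `v` in the comb, in the cyclic order
up, right, down, left. -/
def clockwise (v : ℤ × ℤ) : List (ℤ × ℤ) :=
  [(v.1, v.2 + 1), (v.1 + 1, v.2), (v.1, v.2 - 1), (v.1 - 1, v.2)].filter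
    (fun w => decide (graph.Adj v w))

/-- The initial rotor configuration: rotors above the `x`-axis point up, those below it point down;
on the `x`-axis they point right where `x ≥ 0`, and left where `x < 0`. -/
def initialRotor (v : ℤ × ℤ) : ℤ × ℤ :=
  if 0 < v.2 then (v.1, v.2 + 1)
  else if v.2 < 0 then (v.1, v.2 - 1)
  else if 0 ≤ v.1 then (v.1 + 1, v.2)
  else (v.1 - 1, v.2)

/-- `B_m = {(x, y) : |x| ≤ m, |y| ≤ h (m - |x|)}` for a function `h : ℕ → ℕ`. -/
def ball (h : ℕ → ℕ) (m : ℕ) : Set (ℤ × ℤ) :=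
  {v | v.1.natAbs ≤ m ∧ v.2.natAbs ≤ h (m - v.1.natAbs)}

/-- `h(x) = ⌊(x + 1)² / 3⌋`. -/
def height (x : ℕ) : ℕ := (x + 1) ^ 2 / 3

end Comb

/-! An odometer records how often each vertex emits a particle. The proof is a one-sided least
action principle. Suppose some odometer `us`, supported in `B`, balances the books for turning `n`
particles at `o` into one at each vertex of `B`. Then the actual walks never fire a vertex more
often than `us` does (`IsFilling.exists_exit`), so the cluster stays inside `B` and, by cardinality,
equals `B` (`IsFilling.cluster_eq`). Only this inequality is used: `us` need not be the true
odometer, and no acyclicity of rotors enters.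

For the ball such an odometer is explicit (`odometer_isFilling`). Let `T` be the triangular number
of `H`. A tooth of height `H` can be filled by `E` particles entering from the axis when `T ≤ E ≤ T
+ H` (`tooth_balance`). Along the axis, the outward flow through an edge must exceed the inward flow
by the number of vertices beyond it; this gives the recursion for `turns`. It remains to see that
these flows lie in the required window (`turns_bounds`). This dictates the height: for `h(x)` close
to `x ^ 2 / 3`, the second difference of `h(x) ^ 2 / 2` is `2 * h(x)` to leading order. -/

namespace RotorRouter

variable {V : Type*} [DecidableEq V]

/-! ### Counting emissions and inflows of an odometer. -/

/-- The number of particles that `v` sends to `w` in its first `k` emissions, when the rotors start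
from `ρ`. -/
def sent (c : V → List V) (ρ : V → V) (v w : V) (k : ℕ) : ℕ :=
  ∑ i ∈ Finset.range k, if (succ (c v))^[i + 1] (ρ v) = w then 1 else 0

/-- The rotor configuration after each vertex `v` has emitted `u v` particles. -/
def rotors (c : V → List V) (ρ : V → V) (u : V → ℕ) (v : V) : V :=
  (succ (c v))^[u v] (ρ v)

/-- The number of particles received by `v` from the vertices of `F`, if each vertex `w` emits
`u w` particles. -/
def inflow (c : V → List V) (ρ : V → V) (F : Finset V) (u : V → ℕ) (v : V) : ℕ :=
  ∑ w ∈ F, sent c ρ w v (u w)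

variable {c : V → List V} {ρ : V → V} {o : V} {B : Finset V} {u u' : V → ℕ} {n : ℕ}

@[simp] theorem sent_zero (v w : V) : sent c ρ v w 0 = 0 := by simp [sent]

theorem sent_succ (v w : V) (k : ℕ) :
    sent c ρ v w (k + 1) =
      sent c ρ v w k + if (succ (c v))^[k + 1] (ρ v) = w then 1 else 0 := by
  simp only [sent, Finset.sum_range_succ]

theorem sent_mono (v w : V) : Monotone (sent c ρ v w) := fun _ _ h =>
  Finset.sum_le_sum_of_subset (Finset.range_mono h)

theorem inflow_mono (F : Finset V) (h : u ≤ u') (v : V) :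
    inflow c ρ F u v ≤ inflow c ρ F u' v :=
  Finset.sum_le_sum fun w _ => sent_mono w v (h w)

theorem rotors_zero : rotors c ρ 0 = ρ := by
  funext v
  simp [rotors]

theorem step_rotors (u : V → ℕ) (p : V) :
    step c (rotors c ρ u, p) =
      (rotors c ρ (Function.update u p (u p + 1)), (succ (c p))^[u p + 1] (ρ p)) := by
  have h : succ (c p) (rotors c ρ u p) = (succ (c p))^[u p + 1] (ρ p) := by
    rw [Function.iterate_succ_apply', rotors]
  simp only [step, h, Prod.mk.injEq, and_true]
  funext v
  by_cases hv : v = p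
  · subst hv
    simp [rotors]
  · simp [rotors, hv]

theorem inflow_update {F : Finset V} {p : V} (hp : p ∈ F) (u : V → ℕ) (v : V) :
    inflow c ρ F (Function.update u p (u p + 1)) v =
      inflow c ρ F u v + if v = (succ (c p))^[u p + 1] (ρ p) then 1 else 0 := by
  unfold inflow
  rw [← Finset.add_sum_erase _ _ hp, ← Finset.add_sum_erase F (fun w => sent c ρ w v (u w)) hp]
  have : ∑ w ∈ F.erase p, sent c ρ w v (Function.update u p (u p + 1) w) =
      ∑ w ∈ F.erase p, sent c ρ w v (u w) := by
    refine Finset.sum_congr rfl fun w hw => ?_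
    rw [Function.update_of_ne (Finset.ne_of_mem_erase hw)]
  rw [this, Function.update_self, sent_succ]
  simp only [eq_comm (a := v)]
  ring

/-! ### Fillings and the least action principle. -/

/-- `u` is an odometer that moves `n` particles from `o` to one particle at each vertex of `B`, and
in which only vertices of `B` emit particles. -/
structure IsFilling (c : V → List V) (o : V) (ρ : V → V) (B : Finset V) (n : ℕ) (u : V → ℕ) :
    Prop where
  mem_of_ne_zero : ∀ v, u v ≠ 0 → v ∈ B
  balance : ∀ v, (if v ∈ B then 1 else 0) + u v = (if v = o then n else 0) + inflow c ρ B u v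

namespace IsFilling

theorem source_mem (h : IsFilling c o ρ B n u) (hn : 0 < n) : o ∈ B := by
  by_contra ho
  have h1 := h.balance o
  have h2 : u o = 0 := by_contra fun h' => ho (h.mem_of_ne_zero o h')
  simp only [ho, h2, if_true, if_false] at h1
  omega

theorem inflow_eq_zero (h : IsFilling c o ρ B n u) {v : V} (hv : v ∉ B) :
    inflow c ρ B u v = 0 := by
  have h1 := h.balance v
  have h2 : u v = 0 := by_contra fun h' => hv (h.mem_of_ne_zero v h')
  simp only [hv, h2, if_false] at h1
  omega

/-- No emission leaves `B`, so summing the balance over `B` cancels emissions against inflows. -/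
theorem card_eq (h : IsFilling c o ρ B n u) (hn : 0 < n) : B.card = n := by
  have h1 : ∑ v ∈ B, ((if v ∈ B then 1 else 0) + u v) =
      ∑ v ∈ B, ((if v = o then n else 0) + inflow c ρ B u v) :=
    Finset.sum_congr rfl fun v _ => h.balance v
  have h2 : ∑ v ∈ B, inflow c ρ B u v = ∑ w ∈ B, u w := by
    unfold inflow
    rw [Finset.sum_comm]
    refine Finset.sum_congr rfl fun w hw => ?_
    unfold sent
    rw [Finset.sum_comm]
    have h3 : ∀ i ∈ Finset.range (u w),
        ∑ v ∈ B, (if (succ (c w))^[i + 1] (ρ w) = v then 1 else 0) = 1 := by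
      intro i hi
      rw [Finset.sum_ite_eq, if_pos]
      by_contra hv
      have h4 : sent c ρ w ((succ (c w))^[i + 1] (ρ w)) (u w) = 0 :=
        (Finset.sum_eq_zero_iff.1 (h.inflow_eq_zero hv)) w hw
      have h5 := (Finset.sum_eq_zero_iff.1 h4) i hi
      simp at h5
    rw [Finset.sum_congr rfl h3]
    simp
  rw [Finset.sum_add_distrib, Finset.sum_add_distrib, h2, Finset.sum_ite_eq' B o,
    if_pos (h.source_mem hn)] at h1
  have h3 : ∑ v ∈ B, (if v ∈ B then 1 else 0) = B.card := by simp
  omega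

/-- A walk that is bounded by a filling leaves the cluster inside the filled set. -/
theorem exists_exit {us : V → ℕ} (h : IsFilling c o ρ B n us) {R : Finset V} {k : ℕ} (hk : k ≤ n)
    (N : ℕ) : ∀ (u : V → ℕ) (p : V), ∑ w ∈ B, (us w - u w) ≤ N → u ≤ us → p ∈ B →
      (∀ v, (if v ∈ R then 1 else 0) + (if v = p then 1 else 0) + u v =
        (if v = o then k else 0) + inflow c ρ B u v) →
      ∃ l u' p', (step c)^[l] (rotors c ρ u, p) = (rotors c ρ u', p') ∧
        (∀ i < l, ((step c)^[i] (rotors c ρ u, p)).2 ∈ R) ∧ p' ∉ R ∧ u' ≤ us ∧ p' ∈ B ∧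
        ∀ v, (if v ∈ R then 1 else 0) + (if v = p' then 1 else 0) + u' v =
          (if v = o then k else 0) + inflow c ρ B u' v := by
  induction N with
  | zero =>
    intro u p hN hu hp hL
    by_cases hpR : p ∈ R
    · exfalso
      have h1 := hL p
      have h2 := h.balance p
      have h3 := inflow_mono (c := c) (ρ := ρ) B hu p
      have h4 : us p - u p = 0 :=
        Finset.sum_eq_zero_iff.1 (Nat.le_zero.1 hN) p hp
      have h5 := hu p
      simp only [hpR, hp, if_true] at h1 h2
      split_ifs at h1 h2 <;> omega
    · exact ⟨0, u, p, rfl, by simp, hpR, hu, hp, hL⟩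
  | succ N ih =>
    intro u p hN hu hp hL
    by_cases hpR : p ∈ R
    -- At `p` there are now two particles, the settled one and the walker, while the filling leaves
    -- only one. As `k ≤ n` and inflow is monotone in the odometer, `us` must emit from `p` at least
    -- once more.
    · have hlt : u p < us p := by
        have h1 := hL p
        have h2 := h.balance p
        have h3 := inflow_mono (c := c) (ρ := ρ) B hu p
        simp only [hpR, hp, if_true] at h1 h2
        split_ifs at h1 h2 <;> omega
      set q := (succ (c p))^[u p + 1] (ρ p) with hq
      set u₁ := Function.update u p (u p + 1) with hu₁
      have hu₁p : u₁ p = u p + 1 := Function.update_self ..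
      have hu₁v : ∀ v, v ≠ p → u₁ v = u v := fun v hv => Function.update_of_ne hv ..
      have hle : u₁ ≤ us := by
        intro v
        by_cases hv : v = p
        · subst hv
          rw [hu₁p]
          exact hlt
        · rw [hu₁v v hv]
          exact hu v
      have hin : ∀ v, inflow c ρ B u₁ v = inflow c ρ B u v + if v = q then 1 else 0 :=
        fun v => inflow_update hp u v
      have hqB : q ∈ B := by
        by_contra hqB
        have h1 := h.inflow_eq_zero hqB
        have h2 := inflow_mono (c := c) (ρ := ρ) B hle q
        have h3 := hin q
        simp only [if_true] at h3
        omega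
      have hsum : ∑ w ∈ B, (us w - u₁ w) ≤ N := by
        have : ∑ w ∈ B, (us w - u₁ w) < ∑ w ∈ B, (us w - u w) := by
          refine Finset.sum_lt_sum (fun w _ => ?_) ⟨p, hp, ?_⟩
          · by_cases hw : w = p
            · subst hw
              omega
            · rw [hu₁v w hw]
          · omega
        omega
      have hL₁ : ∀ v, (if v ∈ R then 1 else 0) + (if v = q then 1 else 0) + u₁ v =
          (if v = o then k else 0) + inflow c ρ B u₁ v := by
        intro v
        have h1 := hL v
        rw [hin v]
        by_cases hv : v = p
        · subst hv
          rw [hu₁p]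
          simp only [if_true] at h1
          omega
        · rw [hu₁v v hv]
          rw [if_neg hv] at h1
          omega
      obtain ⟨l, u', p', h1, h2, h3⟩ := ih u₁ q hsum hle hqB hL₁
      have hs : step c (rotors c ρ u, p) = (rotors c ρ u₁, q) := step_rotors u p
      refine ⟨l + 1, u', p', ?_, ?_, h3⟩
      · rw [Function.iterate_succ_apply, hs, h1]
      · intro i hi
        cases i with
        | zero => exact hpR
        | succ i =>
          rw [Function.iterate_succ_apply, hs]
          exact h2 i (by omega)
    · exact ⟨0, u, p, rfl, by simp, hpR, hu, hp, hL⟩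

theorem aggregation_eq {us : V → ℕ} (h : IsFilling c o ρ B n us) (k : ℕ) (hk : k + 1 ≤ n) :
    ∃ (R : Finset V) (u : V → ℕ), aggregation c o ρ (k + 1) = (↑R, rotors c ρ u) ∧
      R ⊆ B ∧ R.card = k + 1 ∧ u ≤ us ∧
      ∀ v, (if v ∈ R then 1 else 0) + u v = (if v = o then k + 1 else 0) + inflow c ρ B u v := by
  induction k with
  | zero =>
    refine ⟨{o}, 0, ?_, ?_, by simp, fun v => Nat.zero_le _, fun v => ?_⟩
    · simp [aggregation, rotors_zero]
    · simpa using h.source_mem hk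
    · simp [inflow]
  | succ k ih =>
    obtain ⟨R, u, h1, hRB, hcard, hu, hL⟩ := ih (by omega)
    have hL' : ∀ v, (if v ∈ R then 1 else 0) + (if v = o then 1 else 0) + u v =
        (if v = o then k + 1 + 1 else 0) + inflow c ρ B u v := by
      intro v
      have := hL v
      split_ifs at this ⊢ <;> omega
    obtain ⟨l, u', p', hl, hin, hout, hu', hp', hL'⟩ :=
      h.exists_exit hk _ u o le_rfl hu (h.source_mem (by omega)) hL'
    refine ⟨insert p' R, u', ?_, ?_, ?_, hu', fun v => ?_⟩
    · have hex : ∃ i, (walk c o (rotors c ρ u) i).2 ∉ (R : Set V) := by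
        refine ⟨l, ?_⟩
        rw [walk, hl]
        simpa using hout
      -- Quantifying over the instance lets this rewrite the `Nat.find` in `addParticle`, whose
      -- decidability is classical.
      have hfind : ∀ [DecidablePred fun i => (walk c o (rotors c ρ u) i).2 ∉ (R : Set V)],
          Nat.find hex = l := by
        intro _
        rw [Nat.find_eq_iff]
        refine ⟨?_, fun i hi => ?_⟩
        · rw [walk, hl]
          simpa using hout
        · simpa [walk] using hin i hi
      rw [aggregation, h1, addParticle, dif_pos hex]
      simp only [hfind]
      rw [walk, hl]
      ext <;> simp
    · exact Finset.insert_subset hp' hRB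
    · rw [Finset.card_insert_of_notMem hout, hcard]
    · have := hL' v
      by_cases hv : v = p'
      · subst hv
        simp only [hout, if_true, if_false, Finset.mem_insert_self] at this ⊢
        omega
      · simp only [Finset.mem_insert, hv, false_or, if_false] at this ⊢
        omega

theorem cluster_eq (h : IsFilling c o ρ B n u) (hn : 0 < n) : cluster c o ρ n = B := by
  obtain ⟨k, rfl⟩ : ∃ k, n = k + 1 := ⟨n - 1, by omega⟩
  obtain ⟨R, u', h1, hRB, hcard, -⟩ := h.aggregation_eq k le_rfl
  rw [cluster, h1, Finset.eq_of_subset_of_card_le hRB (by rw [hcard, h.card_eq hn])]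

end IsFilling

end RotorRouter

namespace Comb

/-! ### Arithmetic of the flow along the axis. -/

/-- The `a`-th triangular number. -/
def triangle (a : ℕ) : ℕ := ∑ i ∈ Finset.range (a + 1), i

theorem triangle_succ (a : ℕ) : triangle (a + 1) = triangle a + (a + 1) :=
  Finset.sum_range_succ _ _

theorem two_mul_triangle (a : ℕ) : 2 * triangle a = a * (a + 1) := by
  induction a with
  | zero => simp [triangle]
  | succ a ih =>
    rw [triangle_succ, mul_add, ih]
    ring

/-- The number of vertices of a ball beyond (and including) the tooth at distance `j` from the
tip. -/
def tail (j : ℕ) : ℕ := ∑ i ∈ Finset.range (j + 1), (1 + 2 * height i)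

theorem tail_succ (j : ℕ) : tail (j + 1) = tail j + (1 + 2 * height (j + 1)) :=
  Finset.sum_range_succ _ _

/-- The number of turns beyond full ones made (twice) at distance `j` from the tip. -/
def carry (j : ℕ) : ℕ := if j = 1 then 1 else 0

/-- The number of full turns of the rotor on the axis at distance `j` from the tip of a ball. -/
def turns : ℕ → ℕ
  | 0 => 0
  | j + 1 => turns j + carry j + tail j

theorem turns_succ (j : ℕ) : turns (j + 1) = turns j + carry j + tail j := rfl

theorem height_three_mul (p : ℕ) : height (3 * p) = 3 * p ^ 2 + 2 * p := by
  have : (3 * p + 1) ^ 2 = 3 * (3 * p ^ 2 + 2 * p) + 1 := by ring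
  rw [height, this]
  omega

theorem height_three_mul_add_one (p : ℕ) : height (3 * p + 1) = 3 * p ^ 2 + 4 * p + 1 := by
  have : (3 * p + 1 + 1) ^ 2 = 3 * (3 * p ^ 2 + 4 * p + 1) + 1 := by ring
  rw [height, this]
  omega

theorem height_three_mul_add_two (p : ℕ) : height (3 * p + 2) = 3 * (p + 1) ^ 2 := by
  have : (3 * p + 2 + 1) ^ 2 = 3 * (3 * (p + 1) ^ 2) := by ring
  rw [height, this]
  omega

/-- The height is a polynomial on each residue class mod 3, hence the induction in steps of three.
With `H = 3 * (p + 1) ^ 2`, the height at `3 * p + 2`, the first two terms for `2 * turns` are `H *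
(H + 1)`; the surplus over the triangular number is thus `(p ^ 2 - p) / 2`, well below `H`. -/
theorem tail_turns_three_mul_add_two (p : ℕ) :
    tail (3 * p + 2) = 6 * (p + 1) ^ 3 + 3 * (p + 1) ^ 2 + 2 * (p + 1) ∧
      2 * turns (3 * p + 2) = 9 * (p + 1) ^ 4 + 3 * (p + 1) ^ 2 + (p ^ 2 - p) := by
  induction p with
  | zero => decide
  | succ p ih =>
    obtain ⟨h1, h2⟩ := ih
    have a0 := height_three_mul (p + 1)
    have a1 := height_three_mul_add_one (p + 1)
    have a2 := height_three_mul_add_two (p + 1)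
    have t0 : tail (3 * (p + 1)) = _ := tail_succ (3 * p + 2)
    have t1 := tail_succ (3 * (p + 1))
    have t2 := tail_succ (3 * (p + 1) + 1)
    have q0 : turns (3 * (p + 1)) = _ := turns_succ (3 * p + 2)
    have q1 := turns_succ (3 * (p + 1))
    have q2 := turns_succ (3 * (p + 1) + 1)
    have c0 : carry (3 * p + 2) = 0 := if_neg (by omega)
    have c1 : carry (3 * (p + 1)) = 0 := if_neg (by omega)
    have c2 : carry (3 * (p + 1) + 1) = 0 := if_neg (by omega)
    have e1 : p ≤ p ^ 2 := Nat.le_self_pow two_ne_zero p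
    have e2 : (p + 1) ≤ (p + 1) ^ 2 := Nat.le_self_pow two_ne_zero _
    rw [show 3 * p + 2 + 1 = 3 * (p + 1) by ring, a0] at t0
    rw [a1] at t1
    rw [show 3 * (p + 1) + 1 + 1 = 3 * (p + 1) + 2 by ring, a2] at t2
    rw [show 3 * (p + 1) + 1 + 1 = 3 * (p + 1) + 2 by ring] at q2
    rw [c0] at q0
    rw [c1] at q1
    rw [c2] at q2
    zify [e1, e2] at *
    constructor
    · rw [t2, t1, t0, h1]
      ring
    · linear_combination h2 + 2 * q2 + 2 * q1 + 2 * q0 + 2 * t1 + 4 * t0 + 6 * h1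

theorem turns_bounds (j : ℕ) : triangle (height j) ≤ turns j ∧
    turns j + carry j ≤ triangle (height j) + height j := by
  obtain hj | ⟨p, hj⟩ : j < 2 ∨ ∃ p, j = 3 * p + 2 ∨ j = 3 * (p + 1) ∨ j = 3 * (p + 1) + 1 := by
    by_cases h : j < 2
    · exact Or.inl h
    · exact Or.inr ⟨(j - 2) / 3, by omega⟩
  -- The case `j = 1` is the only one with a carry. Without it `turns 2` would be 5, below `triangle
  -- (height 2) = 6`.
  · interval_cases j <;> decide
  have c0 : carry (3 * p + 2) = 0 := if_neg (by omega)
  have c1 : carry (3 * (p + 1)) = 0 := if_neg (by omega)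
  have c2 : carry (3 * (p + 1) + 1) = 0 := if_neg (by omega)
  obtain ⟨h1, h2⟩ := tail_turns_three_mul_add_two p
  have t0 : tail (3 * (p + 1)) = _ := tail_succ (3 * p + 2)
  have q0 : turns (3 * (p + 1)) = _ := turns_succ (3 * p + 2)
  have q1 := turns_succ (3 * (p + 1))
  have e1 : p ≤ p ^ 2 := Nat.le_self_pow two_ne_zero p
  rw [show 3 * p + 2 + 1 = 3 * (p + 1) by ring, height_three_mul] at t0
  rw [c0] at q0
  rw [c1] at q1
  have T := two_mul_triangle (height j)
  have key : height j * (height j + 1) ≤ 2 * turns j ∧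
      2 * turns j + 2 * carry j ≤ height j * (height j + 1) + 2 * height j := by
    clear T
    rcases hj with rfl | rfl | rfl
    · rw [height_three_mul_add_two, c0]
      zify [e1] at *
      constructor <;> nlinarith
    · rw [height_three_mul, c1]
      zify [e1] at *
      constructor <;> nlinarith
    · rw [height_three_mul_add_one, c2]
      zify [e1] at *
      constructor <;> nlinarith
  omega

end Comb

namespace Comb

open RotorRouter

/-! ### Rotor sequences and emission counts on the comb. -/

theorem clockwise_axis (x : ℤ) :
    clockwise (x, 0) = [(x, 1), (x + 1, 0), (x, -1), (x - 1, 0)] := by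
  simp [clockwise, graph]

theorem clockwise_of_ne {x y : ℤ} (hy : y ≠ 0) : clockwise (x, y) = [(x, y + 1), (x, y - 1)] := by
  simp [clockwise, graph, hy]

theorem iterate_of_pos {x y : ℤ} (hy : 0 < y) (k : ℕ) :
    (succ (clockwise (x, y)))^[k] (initialRotor (x, y)) =
      if k % 2 = 0 then (x, y + 1) else (x, y - 1) := by
  have h : y + 1 ≠ y - 1 := by omega
  induction k with
  | zero => simp [initialRotor, hy]
  | succ k ih =>
    rw [Function.iterate_succ_apply', ih, clockwise_of_ne hy.ne']
    rcases Nat.mod_two_eq_zero_or_one k with hk | hk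
    · have : (k + 1) % 2 = 1 := by omega
      simp [hk, this, succ]
    · have : (k + 1) % 2 = 0 := by omega
      simp [hk, this, succ, h]

theorem iterate_of_neg {x y : ℤ} (hy : y < 0) (k : ℕ) :
    (succ (clockwise (x, y)))^[k] (initialRotor (x, y)) =
      if k % 2 = 0 then (x, y - 1) else (x, y + 1) := by
  have h : y + 1 ≠ y - 1 := by omega
  induction k with
  | zero => simp [initialRotor, hy, hy.not_gt]
  | succ k ih =>
    rw [Function.iterate_succ_apply', ih, clockwise_of_ne hy.ne]
    rcases Nat.mod_two_eq_zero_or_one k with hk | hk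
    · have : (k + 1) % 2 = 1 := by omega
      simp [hk, this, succ, h]
    · have : (k + 1) % 2 = 0 := by omega
      simp [hk, this, succ]

theorem succ_axis (x : ℤ) :
    succ (clockwise (x, 0)) (x, 1) = (x + 1, 0) ∧ succ (clockwise (x, 0)) (x + 1, 0) = (x, -1) ∧
      succ (clockwise (x, 0)) (x, -1) = (x - 1, 0) ∧
      succ (clockwise (x, 0)) (x - 1, 0) = (x, 1) := by
  have h : x + 1 ≠ x - 1 := by omega
  rw [clockwise_axis]
  simp [succ, h]

theorem iterate_axis_of_nonneg {x : ℤ} (hx : 0 ≤ x) (k : ℕ) :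
    (succ (clockwise (x, 0)))^[k] (initialRotor (x, 0)) =
      if k % 4 = 0 then (x + 1, 0) else if k % 4 = 1 then (x, -1)
      else if k % 4 = 2 then (x - 1, 0) else (x, 1) := by
  obtain ⟨h1, h2, h3, h4⟩ := succ_axis x
  induction k with
  | zero => simp [initialRotor, hx]
  | succ k ih =>
    rw [Function.iterate_succ_apply', ih]
    obtain hk | hk | hk | hk : k % 4 = 0 ∨ k % 4 = 1 ∨ k % 4 = 2 ∨ k % 4 = 3 := by omega
    all_goals simp [hk, Nat.add_mod, h1, h2, h3, h4]

theorem iterate_axis_of_neg {x : ℤ} (hx : x < 0) (k : ℕ) :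
    (succ (clockwise (x, 0)))^[k] (initialRotor (x, 0)) =
      if k % 4 = 0 then (x - 1, 0) else if k % 4 = 1 then (x, 1)
      else if k % 4 = 2 then (x + 1, 0) else (x, -1) := by
  obtain ⟨h1, h2, h3, h4⟩ := succ_axis x
  induction k with
  | zero => simp [initialRotor, hx]
  | succ k ih =>
    rw [Function.iterate_succ_apply', ih]
    obtain hk | hk | hk | hk : k % 4 = 0 ∨ k % 4 = 1 ∨ k % 4 = 2 ∨ k % 4 = 3 := by omega
    all_goals simp [hk, Nat.add_mod, h1, h2, h3, h4]

/-- The number of particles that `v` sends to `w` in its first `k` emissions. -/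
def out (v w : ℤ × ℤ) (k : ℕ) : ℕ := sent clockwise initialRotor v w k

/-- The rotor starts pointing away from the axis and turns before each move, so the odd emissions go
towards the axis and that count is rounded up. -/
theorem out_of_pos {x y : ℤ} (hy : 0 < y) (a b : ℤ) (k : ℕ) :
    out (x, y) (a, b) k =
      if a = x ∧ b = y + 1 then k / 2 else if a = x ∧ b = y - 1 then (k + 1) / 2 else 0 := by
  unfold out
  induction k with
  | zero => simp
  | succ k ih =>
    rw [sent_succ, ih, iterate_of_pos hy]
    rcases Nat.mod_two_eq_zero_or_one (k + 1) with hk | hk <;>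
    simp only [hk, Prod.mk.injEq, if_true, one_ne_zero, if_false] <;> split_ifs <;> omega

theorem out_of_neg {x y : ℤ} (hy : y < 0) (a b : ℤ) (k : ℕ) :
    out (x, y) (a, b) k =
      if a = x ∧ b = y - 1 then k / 2 else if a = x ∧ b = y + 1 then (k + 1) / 2 else 0 := by
  unfold out
  induction k with
  | zero => simp
  | succ k ih =>
    rw [sent_succ, ih, iterate_of_neg hy]
    rcases Nat.mod_two_eq_zero_or_one (k + 1) with hk | hk <;>
    simp only [hk, Prod.mk.injEq, if_true, one_ne_zero, if_false] <;> split_ifs <;> omega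

/-- Starting from right, the emissions go down, left, up, right; the rounding reflects this order.
-/
theorem out_axis_of_nonneg {x : ℤ} (hx : 0 ≤ x) (a b : ℤ) (k : ℕ) :
    out (x, 0) (a, b) k =
      if a = x + 1 ∧ b = 0 then k / 4 else if a = x ∧ b = 1 then (k + 1) / 4
      else if a = x - 1 ∧ b = 0 then (k + 2) / 4 else if a = x ∧ b = -1 then (k + 3) / 4
      else 0 := by
  unfold out
  induction k with
  | zero => simp
  | succ k ih =>
    rw [sent_succ, ih, iterate_axis_of_nonneg hx]
    obtain hk | hk | hk | hk : (k + 1) % 4 = 0 ∨ (k + 1) % 4 = 1 ∨ (k + 1) % 4 = 2 ∨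
      (k + 1) % 4 = 3 := by omega
    all_goals
      simp only [hk, Prod.mk.injEq, if_true, one_ne_zero, if_false, OfNat.ofNat_ne_zero,
        OfNat.ofNat_ne_one, Nat.reduceEqDiff]
      split_ifs <;> omega

theorem out_axis_of_neg {x : ℤ} (hx : x < 0) (a b : ℤ) (k : ℕ) :
    out (x, 0) (a, b) k =
      if a = x - 1 ∧ b = 0 then k / 4 else if a = x ∧ b = -1 then (k + 1) / 4
      else if a = x + 1 ∧ b = 0 then (k + 2) / 4 else if a = x ∧ b = 1 then (k + 3) / 4
      else 0 := by
  unfold out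
  induction k with
  | zero => simp
  | succ k ih =>
    rw [sent_succ, ih, iterate_axis_of_neg hx]
    obtain hk | hk | hk | hk : (k + 1) % 4 = 0 ∨ (k + 1) % 4 = 1 ∨ (k + 1) % 4 = 2 ∨
      (k + 1) % 4 = 3 := by omega
    all_goals
      simp only [hk, Prod.mk.injEq, if_true, one_ne_zero, if_false, OfNat.ofNat_ne_zero,
        OfNat.ofNat_ne_one, Nat.reduceEqDiff]
      split_ifs <;> omega

/-- A vertex receives particles only from its neighbours. -/
theorem out_eq_zero {x y a b : ℤ} (h : ¬(a = x ∧ (b = y + 1 ∨ b = y - 1)))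
    (h' : ¬(y = 0 ∧ b = 0 ∧ (a = x + 1 ∨ a = x - 1))) (k : ℕ) : out (x, y) (a, b) k = 0 := by
  rcases lt_trichotomy y 0 with hy | rfl | hy
  · rw [out_of_neg hy]
    split_ifs <;> omega
  · rcases lt_or_ge x 0 with hx | hx
    · rw [out_axis_of_neg hx]
      split_ifs <;> omega
    · rw [out_axis_of_nonneg hx]
      split_ifs <;> omega
  · rw [out_of_pos hy]
    split_ifs <;> omega

theorem inflow_eq_sum {B : Finset (ℤ × ℤ)} {u : ℤ × ℤ → ℕ} (hu : ∀ v, u v ≠ 0 → v ∈ B)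
    (G : Finset (ℤ × ℤ)) (v : ℤ × ℤ) (hG : ∀ w ∉ G, ∀ k, out w v k = 0) :
    inflow clockwise initialRotor B u v = ∑ w ∈ G, out w v (u w) := by
  refine Finset.sum_congr_of_eq_on_inter (fun w _ hw => hG w hw _) (fun w _ hw => ?_)
    (fun w _ _ => rfl)
  have : u w = 0 := by_contra fun h => hw (hu w h)
  rw [this]
  exact sent_zero _ _

theorem inflow_of_ne {B : Finset (ℤ × ℤ)} {u : ℤ × ℤ → ℕ} (hu : ∀ v, u v ≠ 0 → v ∈ B)
    {x y : ℤ} (hy : y ≠ 0) :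
    inflow clockwise initialRotor B u (x, y) =
      out (x, y + 1) (x, y) (u (x, y + 1)) + out (x, y - 1) (x, y) (u (x, y - 1)) := by
  rw [inflow_eq_sum hu {(x, y + 1), (x, y - 1)}, Finset.sum_pair]
  · simp only [ne_eq, Prod.mk.injEq]
    omega
  · rintro ⟨a, b⟩ hw k
    simp only [Finset.mem_insert, Finset.mem_singleton, Prod.mk.injEq] at hw
    apply out_eq_zero <;> omega

theorem inflow_axis {B : Finset (ℤ × ℤ)} {u : ℤ × ℤ → ℕ} (hu : ∀ v, u v ≠ 0 → v ∈ B) (x : ℤ) :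
    inflow clockwise initialRotor B u (x, 0) =
      out (x, 1) (x, 0) (u (x, 1)) + (out (x, -1) (x, 0) (u (x, -1)) +
        (out (x + 1, 0) (x, 0) (u (x + 1, 0)) + out (x - 1, 0) (x, 0) (u (x - 1, 0)))) := by
  rw [inflow_eq_sum hu {(x, 1), (x, -1), (x + 1, 0), (x - 1, 0)}, Finset.sum_insert,
    Finset.sum_insert, Finset.sum_pair]
  · simp only [ne_eq, Prod.mk.injEq]
    omega
  · simp
  · simp
  · rintro ⟨a, b⟩ hw k
    simp only [Finset.mem_insert, Finset.mem_singleton, Prod.mk.injEq] at hw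
    apply out_eq_zero <;> omega

/-! ### Filling a single tooth. -/

/-- The number of particles moved away from the axis by the vertex at height `y` in a tooth of
height `H` that is entered by `E` particles. -/
def ascents (H E y : ℕ) : ℕ := triangle (H - y) + (E - triangle H - y)

/-- The number of particles moved towards the axis by the vertex at height `y` in a tooth of
height `H` that is entered by `E` particles. -/
def descents (H E y : ℕ) : ℕ := triangle (H - y) + (E - triangle H + 1 - y)

/-- `descents` exceeds `ascents` by one for `y ≤ E - triangle H` and equals it otherwise, as an
alternating rotor that first sends towards the axis requires. -/
theorem half_ascents_add_descents (H E y : ℕ) :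
    (ascents H E y + descents H E y) / 2 = ascents H E y := by
  unfold ascents descents
  omega

theorem half_ascents_add_descents_add_one (H E y : ℕ) :
    (ascents H E y + descents H E y + 1) / 2 = descents H E y := by
  unfold ascents descents
  omega

/-- The net flow from height `y` to `y + 1` is the number `H - y` of vertices above. The surplus
terms agree at adjacent heights, and the triangular numbers differ by `H - y`. -/
theorem ascents_eq {H E : ℕ} (h2 : E ≤ triangle H + H) (y : ℕ) :
    ascents H E y = descents H E (y + 1) + (H - y) := by
  unfold ascents descents
  rcases lt_or_ge y H with h | h
  · obtain ⟨d, hd⟩ : ∃ d, H - y = d + 1 := ⟨H - y - 1, by omega⟩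
    have : H - (y + 1) = d := by omega
    rw [hd, this, triangle_succ]
    omega
  · have h3 : H - y = 0 := by omega
    have h4 : H - (y + 1) = 0 := by omega
    rw [h3, h4]
    omega

theorem tooth_balance {H E : ℕ} (h2 : E ≤ triangle H + H) (y : ℕ) :
    (if y + 1 ≤ H then 1 else 0) + (ascents H E (y + 1) + descents H E (y + 1)) =
      ascents H E y + descents H E (y + 1 + 1) := by
  have h3 := ascents_eq h2 y
  have h4 := ascents_eq h2 (y + 1)
  split_ifs <;> omega

theorem ascents_zero {H E : ℕ} (h1 : triangle H ≤ E) : ascents H E 0 = E := by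
  unfold ascents
  rw [Nat.sub_zero]
  omega

theorem ascents_add_descents_eq_zero {H E y : ℕ} (h2 : E ≤ triangle H + H) (hy : H < y) :
    ascents H E y + descents H E y = 0 := by
  have h3 : H - y = 0 := by omega
  have h4 : triangle 0 = 0 := rfl
  unfold ascents descents
  rw [h3, h4]
  omega

/-! ### The odometer of the ball and its vertical flows. -/

/-- The number of particles entering the tooth above `(x, 0)`. -/
def enterUp (m : ℕ) (x : ℤ) : ℕ :=
  turns (m - x.natAbs) + if x < 0 then carry (m - x.natAbs) else 0

/-- The number of particles entering the tooth below `(x, 0)`. -/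
def enterDown (m : ℕ) (x : ℤ) : ℕ :=
  turns (m - x.natAbs) + if 0 < x then carry (m - x.natAbs) else 0

/-- An odometer that fills the ball of radius `m`. -/
def odometer (m : ℕ) (v : ℤ × ℤ) : ℕ :=
  if v.2 = 0 then
    4 * turns (m - v.1.natAbs) + if v.1 = 0 then 0 else 2 * carry (m - v.1.natAbs)
  else if 0 < v.2 then
    ascents (height (m - v.1.natAbs)) (enterUp m v.1) v.2.natAbs +
      descents (height (m - v.1.natAbs)) (enterUp m v.1) v.2.natAbs
  else
    ascents (height (m - v.1.natAbs)) (enterDown m v.1) v.2.natAbs +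
      descents (height (m - v.1.natAbs)) (enterDown m v.1) v.2.natAbs

theorem enterUp_bounds (m : ℕ) (x : ℤ) :
    triangle (height (m - x.natAbs)) ≤ enterUp m x ∧
      enterUp m x ≤ triangle (height (m - x.natAbs)) + height (m - x.natAbs) := by
  have := turns_bounds (m - x.natAbs)
  unfold enterUp
  split_ifs <;> omega

theorem enterDown_bounds (m : ℕ) (x : ℤ) :
    triangle (height (m - x.natAbs)) ≤ enterDown m x ∧
      enterDown m x ≤ triangle (height (m - x.natAbs)) + height (m - x.natAbs) := by
  have := turns_bounds (m - x.natAbs)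
  unfold enterDown
  split_ifs <;> omega

theorem odometer_axis (m : ℕ) (x : ℤ) : odometer m (x, 0) =
    4 * turns (m - x.natAbs) + if x = 0 then 0 else 2 * carry (m - x.natAbs) := if_pos rfl

theorem odometer_up (m : ℕ) (x : ℤ) (y : ℕ) : odometer m (x, (y : ℤ) + 1) =
    ascents (height (m - x.natAbs)) (enterUp m x) (y + 1) +
      descents (height (m - x.natAbs)) (enterUp m x) (y + 1) := by
  have h : ((y : ℤ) + 1).natAbs = y + 1 := by omega
  rw [odometer, if_neg (show ((y : ℤ) + 1) ≠ 0 by omega),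
    if_pos (show 0 < ((y : ℤ) + 1) by omega), h]

theorem odometer_down (m : ℕ) (x : ℤ) (y : ℕ) : odometer m (x, -((y : ℤ) + 1)) =
    ascents (height (m - x.natAbs)) (enterDown m x) (y + 1) +
      descents (height (m - x.natAbs)) (enterDown m x) (y + 1) := by
  have h : (-((y : ℤ) + 1)).natAbs = y + 1 := by omega
  rw [odometer, if_neg (show -((y : ℤ) + 1) ≠ 0 by omega),
    if_neg (show ¬ 0 < -((y : ℤ) + 1) by omega), h]

/-- At `y = 0` the half turn of a carry sends its first particle up where `x < 0` and down where `x
> 0`; hence the asymmetry of `enterUp` and `enterDown`. -/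
theorem out_up (m : ℕ) (x : ℤ) (y : ℕ) :
    out (x, y) (x, (y : ℤ) + 1) (odometer m (x, y)) =
      ascents (height (m - x.natAbs)) (enterUp m x) y := by
  cases y with
  | zero =>
    rw [ascents_zero (enterUp_bounds m x).1, Nat.cast_zero, odometer_axis]
    rcases lt_or_ge x 0 with hx | hx
    · have : carry (m - x.natAbs) ≤ 1 := by unfold carry; split_ifs <;> omega
      rw [out_axis_of_neg hx, enterUp, if_pos hx, if_neg hx.ne]
      split_ifs <;> omega
    · have : carry (m - x.natAbs) ≤ 1 := by unfold carry; split_ifs <;> omega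
      rw [out_axis_of_nonneg hx, enterUp, if_neg hx.not_gt]
      split_ifs <;> omega
  | succ y =>
    rw [Nat.cast_succ, odometer_up, out_of_pos (by omega), if_pos (by simp),
      half_ascents_add_descents]

theorem out_down (m : ℕ) (x : ℤ) (y : ℕ) :
    out (x, -y) (x, -((y : ℤ) + 1)) (odometer m (x, -y)) =
      ascents (height (m - x.natAbs)) (enterDown m x) y := by
  cases y with
  | zero =>
    rw [ascents_zero (enterDown_bounds m x).1, Nat.cast_zero, neg_zero, odometer_axis]
    have : carry (m - x.natAbs) ≤ 1 := by unfold carry; split_ifs <;> omega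
    rcases lt_or_ge x 0 with hx | hx
    · rw [out_axis_of_neg hx, enterDown, if_neg hx.not_gt, if_neg hx.ne]
      split_ifs <;> omega
    · rw [out_axis_of_nonneg hx, enterDown]
      split_ifs <;> omega
  | succ y =>
    rw [Nat.cast_succ, odometer_down, out_of_neg (by omega), if_pos ⟨rfl, by ring⟩,
      half_ascents_add_descents]

theorem out_from_above (m : ℕ) (x : ℤ) (y : ℕ) :
    out (x, (y : ℤ) + 1) (x, y) (odometer m (x, (y : ℤ) + 1)) =
      descents (height (m - x.natAbs)) (enterUp m x) (y + 1) := by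
  rw [odometer_up, out_of_pos (by omega), if_neg (by omega), if_pos (by simp),
    half_ascents_add_descents_add_one]

theorem out_from_below (m : ℕ) (x : ℤ) (y : ℕ) :
    out (x, -((y : ℤ) + 1)) (x, -y) (odometer m (x, -((y : ℤ) + 1))) =
      descents (height (m - x.natAbs)) (enterDown m x) (y + 1) := by
  rw [odometer_down, out_of_neg (by omega), if_neg (by omega), if_pos ⟨rfl, by ring⟩,
    half_ascents_add_descents_add_one]

theorem ball_finite (h : ℕ → ℕ) (m : ℕ) : (ball h m).Finite := by
  refine ((Set.finite_Icc (-(m : ℤ)) m).prod (Set.finite_Icc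
    (-((∑ i ∈ Finset.range (m + 1), h i : ℕ) : ℤ))
      (∑ i ∈ Finset.range (m + 1), h i : ℕ))).subset ?_
  rintro ⟨x, y⟩ ⟨h1, h2⟩
  have h3 : h (m - x.natAbs) ≤ ∑ i ∈ Finset.range (m + 1), h i :=
    Finset.single_le_sum (f := h) (fun _ _ => Nat.zero_le _) (by simp)
  dsimp only at h1 h2
  simp only [Set.mem_prod, Set.mem_Icc]
  omega

theorem odometer_eq_zero {m : ℕ} {v : ℤ × ℤ} (hv : v ∉ ball height m) : odometer m v = 0 := by
  obtain ⟨x, y⟩ := v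
  have hv' : x.natAbs ≤ m → height (m - x.natAbs) < y.natAbs := by
    intro hx
    by_contra h
    exact hv ⟨hx, not_lt.1 h⟩
  -- Beyond the tip, truncated subtraction gives distance 0, where `height`, `turns` and `carry` all
  -- vanish.
  have hout : m < x.natAbs → m - x.natAbs = 0 := by omega
  have hh : y ≠ 0 → height (m - x.natAbs) < y.natAbs := by
    intro hy
    rcases le_or_gt x.natAbs m with hx | hx
    · exact hv' hx
    · rw [hout hx]
      exact Int.natAbs_pos.2 hy
  rw [odometer]
  dsimp only
  split_ifs with h1 h2
  · subst h2
    have := hv'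
    simp at this
    omega
  · have hx : m < x.natAbs := by
      by_contra hx
      have := hv' (not_lt.1 hx)
      rw [h1] at this
      simp at this
    rw [hout hx]
    rfl
  · exact ascents_add_descents_eq_zero (enterUp_bounds m x).2 (hh h1)
  · exact ascents_add_descents_eq_zero (enterDown_bounds m x).2 (hh h1)

/-! ### Horizontal flows and the balance at every vertex. -/

theorem out_right_of_nonneg {x : ℤ} (hx : 0 ≤ x) (m : ℕ) :
    out (x, 0) (x + 1, 0) (odometer m (x, 0)) = turns (m - x.natAbs) := by
  have : carry (m - x.natAbs) ≤ 1 := by unfold carry; split_ifs <;> omega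
  rw [out_axis_of_nonneg hx, odometer_axis, if_pos (by simp)]
  split_ifs <;> omega

/-- Away from the origin, the inward direction is second and the outward one last in the emission
order, so the two extra emissions of a carry add to the inward flow only. -/
theorem out_left_of_pos {x : ℤ} (hx : 0 < x) (m : ℕ) :
    out (x, 0) (x - 1, 0) (odometer m (x, 0)) =
      turns (m - x.natAbs) + carry (m - x.natAbs) := by
  have : carry (m - x.natAbs) ≤ 1 := by unfold carry; split_ifs <;> omega
  rw [out_axis_of_nonneg hx.le, odometer_axis, if_neg (by omega), if_neg (by omega),
    if_pos (by simp), if_neg (by omega)]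
  omega

theorem out_left_of_nonpos {x : ℤ} (hx : x ≤ 0) (m : ℕ) :
    out (x, 0) (x - 1, 0) (odometer m (x, 0)) = turns (m - x.natAbs) := by
  have : carry (m - x.natAbs) ≤ 1 := by unfold carry; split_ifs <;> omega
  rcases hx.lt_or_eq with hx | rfl
  · rw [out_axis_of_neg hx, odometer_axis, if_pos (by simp)]
    split_ifs <;> omega
  · rw [out_axis_of_nonneg le_rfl, odometer_axis, if_pos rfl, if_neg (by omega),
      if_neg (by omega), if_pos (by simp)]
    omega

theorem out_right_of_neg {x : ℤ} (hx : x < 0) (m : ℕ) :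
    out (x, 0) (x + 1, 0) (odometer m (x, 0)) =
      turns (m - x.natAbs) + carry (m - x.natAbs) := by
  have : carry (m - x.natAbs) ≤ 1 := by unfold carry; split_ifs <;> omega
  rw [out_axis_of_neg hx, odometer_axis, if_neg (by omega), if_neg (by omega),
    if_pos (by simp), if_neg (by omega)]
  omega

theorem turns_second_difference (j : ℕ) :
    turns (j + 2) + (turns j + carry j) =
      2 * turns (j + 1) + carry (j + 1) + (1 + 2 * height (j + 1)) := by
  have h1 := turns_succ j
  have h2 := turns_succ (j + 1)
  have h3 := tail_succ j
  rw [show j + 1 + 1 = j + 2 from rfl] at h2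
  omega

/-- The horizontal balance away from the origin, at distance `d + 1` from it. -/
theorem turns_balance (m d : ℕ) :
    (if d + 1 ≤ m then 1 + 2 * height (m - (d + 1)) else 0) +
        (2 * turns (m - (d + 1)) + carry (m - (d + 1))) =
      turns (m - d) + (turns (m - (d + 2)) + carry (m - (d + 2))) := by
  split_ifs with h
  · obtain ⟨j, rfl⟩ : ∃ j, m = d + 1 + j := ⟨m - (d + 1), by omega⟩
    cases j with
    | zero =>
      rw [show d + 1 + 0 - (d + 1) = 0 by omega, show d + 1 + 0 - d = 1 by omega,
        show d + 1 + 0 - (d + 2) = 0 by omega]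
      rfl
    | succ j =>
      have := turns_second_difference j
      rw [show d + 1 + (j + 1) - (d + 1) = j + 1 by omega,
        show d + 1 + (j + 1) - d = j + 2 by omega, show d + 1 + (j + 1) - (d + 2) = j by omega]
      omega
  · rw [show m - (d + 1) = 0 by omega, show m - d = 0 by omega, show m - (d + 2) = 0 by omega]
    rfl

theorem height_eq_zero_of_lt {m d : ℕ} (h : m < d) : height (m - d) = 0 := by
  rw [Nat.sub_eq_zero_of_le h.le]
  rfl

theorem odometer_isFilling (m : ℕ) :
    IsFilling clockwise (0, 0) initialRotor (ball_finite height m).toFinset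
      (2 * tail m - (1 + 2 * height m)) (odometer m) := by
  have hsupp : ∀ v, odometer m v ≠ 0 → v ∈ (ball_finite height m).toFinset := by
    intro v hv
    rw [Set.Finite.mem_toFinset]
    by_contra h
    exact hv (odometer_eq_zero h)
  refine ⟨hsupp, ?_⟩
  rintro ⟨x, y⟩
  have hmem : (x, y) ∈ (ball_finite height m).toFinset ↔
      x.natAbs ≤ m ∧ y.natAbs ≤ height (m - x.natAbs) := by
    rw [Set.Finite.mem_toFinset]
    rfl
  have hmem' : y ≠ 0 → ((x, y) ∈ (ball_finite height m).toFinset ↔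
      y.natAbs ≤ height (m - x.natAbs)) := by
    intro hy
    rw [hmem, and_iff_right_iff_imp]
    intro h
    by_contra h'
    rw [height_eq_zero_of_lt (not_le.1 h')] at h
    omega
  have hne : y ≠ 0 → (x, y) ≠ (0, 0) := fun hy h => hy (congrArg Prod.snd h)
  rcases lt_trichotomy y 0 with hy | rfl | hy
  · obtain ⟨z, rfl⟩ : ∃ z : ℕ, y = -((z : ℤ) + 1) := ⟨(-y - 1).toNat, by omega⟩
    have h1 := out_down m x z
    have h2 := out_from_below m x (z + 1)
    have h3 := tooth_balance (enterDown_bounds m x).2 z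
    have h4 : (-((z : ℤ) + 1)).natAbs = z + 1 := by omega
    rw [Nat.cast_succ] at h2
    rw [inflow_of_ne hsupp hy.ne, show -((z : ℤ) + 1) + 1 = -z by ring,
      show -((z : ℤ) + 1) - 1 = -(z + 1 + 1) by ring, h1, h2, odometer_down,
      if_neg (hne hy.ne)]
    simp only [hmem' hy.ne, h4]
    omega
  -- By `ascents_eq` at height 0, each tooth returns what entered it minus its height, so the
  -- balance at an axis vertex becomes that of its whole column.
  · have hbal : ∀ I : ℕ,
        (if x.natAbs ≤ m then 1 + 2 * height (m - x.natAbs) else 0) + odometer m (x, 0) =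
          (if x = 0 then 2 * tail m - (1 + 2 * height m) else 0) +
            (enterUp m x + enterDown m x) + I →
        (if x.natAbs ≤ m then 1 else 0) + odometer m (x, 0) =
          (if x = 0 then 2 * tail m - (1 + 2 * height m) else 0) +
          (descents (height (m - x.natAbs)) (enterUp m x) 1 +
            (descents (height (m - x.natAbs)) (enterDown m x) 1 + I)) := by
      intro I hI
      have h1 : _ = descents _ _ 1 + _ := ascents_eq (enterUp_bounds m x).2 0
      have h2 : _ = descents _ _ 1 + _ := ascents_eq (enterDown_bounds m x).2 0
      rw [ascents_zero (enterUp_bounds m x).1] at h1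
      rw [ascents_zero (enterDown_bounds m x).1] at h2
      have h3 : m < x.natAbs → height (m - x.natAbs) = 0 := height_eq_zero_of_lt
      split_ifs at hI ⊢ <;> omega
    have h1 := out_from_above m x 0
    have h2 := out_from_below m x 0
    simp only [Nat.cast_zero, zero_add, neg_zero] at h1 h2
    rw [inflow_axis hsupp, h1, h2]
    simp only [hmem, Int.natAbs_zero, Nat.zero_le, and_true, Prod.mk.injEq]
    apply hbal
    rw [odometer_axis, enterUp, enterDown]
    rcases lt_trichotomy x 0 with hx | rfl | hx
    · have h3 := out_left_of_nonpos (show x + 1 ≤ 0 by omega) m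
      have h4 := out_right_of_neg (show x - 1 < 0 by omega) m
      rw [add_sub_cancel_right] at h3
      rw [sub_add_cancel] at h4
      obtain ⟨d, rfl⟩ : ∃ d : ℕ, x = -((d : ℤ) + 1) := ⟨(-x - 1).toNat, by omega⟩
      rw [show (-((d : ℤ) + 1) + 1).natAbs = d by omega] at h3
      rw [show (-((d : ℤ) + 1) - 1).natAbs = d + 2 by omega] at h4
      rw [h3, h4, show (-((d : ℤ) + 1)).natAbs = d + 1 by omega, if_neg hx.ne, if_neg hx.ne,
        if_pos hx, if_neg hx.not_gt]
      have := turns_balance m d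
      omega
    · have h3 := out_left_of_pos (show (0 : ℤ) < 0 + 1 by omega) m
      have h4 := out_right_of_neg (show (0 : ℤ) - 1 < 0 by omega) m
      rw [add_sub_cancel_right] at h3
      rw [sub_add_cancel] at h4
      rw [h3, h4]
      simp only [Int.natAbs_zero, Nat.sub_zero, Nat.zero_le, if_true, lt_irrefl, if_false]
      rw [show ((0 : ℤ) + 1).natAbs = 1 from rfl, show ((0 : ℤ) - 1).natAbs = 1 from rfl]
      cases m with
      | zero => decide
      | succ m =>
        have h5 := turns_succ m
        have h6 := tail_succ m
        rw [Nat.add_sub_cancel]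
        omega
    · have h3 := out_left_of_pos (show 0 < x + 1 by omega) m
      have h4 := out_right_of_nonneg (show 0 ≤ x - 1 by omega) m
      rw [add_sub_cancel_right] at h3
      rw [sub_add_cancel] at h4
      obtain ⟨d, rfl⟩ : ∃ d : ℕ, x = (d : ℤ) + 1 := ⟨(x - 1).toNat, by omega⟩
      rw [show ((d : ℤ) + 1 + 1).natAbs = d + 2 by omega] at h3
      rw [show ((d : ℤ) + 1 - 1).natAbs = d by omega] at h4
      rw [h3, h4, show ((d : ℤ) + 1).natAbs = d + 1 by omega, if_neg hx.ne', if_neg hx.ne',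
        if_pos hx, if_neg hx.not_gt]
      have := turns_balance m d
      omega
  · obtain ⟨z, rfl⟩ : ∃ z : ℕ, y = (z : ℤ) + 1 := ⟨(y - 1).toNat, by omega⟩
    have h1 := out_up m x z
    have h2 := out_from_above m x (z + 1)
    have h3 := tooth_balance (enterUp_bounds m x).2 z
    have h4 : ((z : ℤ) + 1).natAbs = z + 1 := by omega
    rw [Nat.cast_succ] at h2
    rw [inflow_of_ne hsupp hy.ne', add_sub_cancel_right, h1, h2, odometer_up,
      if_neg (hne hy.ne')]
    simp only [hmem' hy.ne', h4]
    omega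

theorem two_mul_tail_sub_pos (m : ℕ) : 0 < 2 * tail m - (1 + 2 * height m) := by
  have : 1 + 2 * height m ≤ tail m :=
    Finset.single_le_sum (f := fun i => 1 + 2 * height i) (fun _ _ => Nat.zero_le _) (by simp)
  omega

end Comb

theorem theorem1 (m : ℕ) :
    RotorRouter.cluster Comb.clockwise (0, 0) Comb.initialRotor
        (Comb.ball Comb.height m).ncard =
      Comb.ball Comb.height m := by
  have h := Comb.odometer_isFilling m
  have hpos := Comb.two_mul_tail_sub_pos m
  -- The size of the ball is read off from the filling rather than counted.
  rw [Set.ncard_eq_toFinset_card _ (Comb.ball_finite Comb.height m), h.card_eq hpos,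
    h.cluster_eq hpos, Set.Finite.coe_toFinset]
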